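/- Let $F$ be a number field. Let $\mathfrak F_1$ be the set of unitary idele class characters of $F$, and let $\mathfrak F_2$ be the set of cuspidal automorphic representations of $\mathrm{GL}_2(\mathbb A_F)$ with unitary central character, realised as the irreducible closed invariant subspaces of the cuspidal part of $L^2(\mathrm{GL}_2(F)\backslash \mathrm{GL}_2(\mathbb A_F),\omega)$, with $\omega$ the central character. Let $\pi,\pi'\in\mathfrak F_2$, with central characters $\omega_\pi,\omega_{\pi'}$, and let $\chi\in\mathfrak F_1$. Suppose that $\pi\not\sim\pi'$, i.e. there is no $\psi\in\mathfrak F_1$ with $\pi'=\pi\otimes\psi$. Write $\mathrm{Ad}(\pi)=\mathrm{Sym}^2(\pi)\otimes\overline\omega_\pi$ and $$\begin{aligned} \mathcal D(s)={}&\zeta_F(s)^6\,L(s,\mathrm{Ad}(\pi)\times(\mathrm{Ad}(\pi')\otimes\chi))^4\,L(s,\mathrm{Ad}(\pi)\times(\mathrm{Ad}(\pi')\otimes\overline\chi))^4\\ &\cdot L(s,\mathrm{Ad}(\pi))^7L(s,\mathrm{Ad}(\pi'))^2L(s,\mathrm{Ad}(\pi')\otimes\chi)^2L(s,\mathrm{Ad}(\pi')\otimes\overline\chi)^2\\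 &\cdot L(s,\mathrm{Sym}^4(\pi)\otimes\overline\omega_\pi^2)^5L(s,\mathrm{Sym}^4(\pi')\otimes\overline\omega_{\pi'}^2)^2L(s,\mathrm{Ad}(\pi)\times\mathrm{Ad}(\pi'))^3\\ &\cdot L(s,\mathrm{Ad}(\pi)\times(\mathrm{Sym}^4(\pi')\otimes\overline\omega_{\pi'}^2))^3L(s,\mathrm{Ad}(\pi')\times(\mathrm{Sym}^4(\pi)\otimes\overline\omega_\pi^2))\\ &\cdot L(s,\mathrm{Ad}(\pi')\times(\mathrm{Sym}^4(\pi)\otimes\chi\overline\omega_\pi^2))^2L(s,\mathrm{Ad}(\pi')\times(\mathrm{Sym}^4(\pi)\otimes\overline\chi\,\overline\omega_\pi^2))^2\\ &\cdot L(s,\mathrm{Sym}^4(\pi)\times(\mathrm{Sym}^4(\pi')\otimes\overline\omega_\pi^2\overline\omega_{\pi'}^2)). \end{aligned}$$ Let $v$ be a finite place of $F$ at which $\pi,\pi',\chi$ are unramified, with residue cardinality $q_v$ and uniformizer $\varpi$. Let $\alpha_1,\alpha_2$ be the Satake parameters of $\pi$ at $v$: on the $\mathrm{GL}_2(\mathcal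 O_v)$-fixed vectors of $\pi$, the double cosets of $\mathrm{diag}(\varpi,1)$ and $\mathrm{diag}(\varpi,\varpi)$ act by $q_v^{1/2}(\alpha_1+\alpha_2)$ and $\alpha_1\alpha_2$. Let $\alpha_1',\alpha_2'$ be those of $\pi'$. The Euler factor $\mathcal D_v(s)$ of $\mathcal D$ at $v$ is the product of the unramified Euler factors $\prod_{\beta}(1-\beta q_v^{-s})^{-1}$ of the $L$-functions above, where $\beta$ runs over the following local parameters: $1$ for $\zeta_F$; $\alpha_1^j\alpha_2^{m-j}$ $(0\le j\le m)$ for $\mathrm{Sym}^m(\pi)$, and similarly for $\pi'$; the parameters multiplied by $\psi_v(\varpi)$ for a twist by a character $\psi$; and all products of one parameter of each representation for a Rankin--Selberg convolution $\times$. For $\ell\ge1$ let $a_{\mathcal D}(v^\ell)$ be the sum of the $\ell$-th powers of the local parameters $\beta$ of all $L$-functions in $\mathcal D$, each counted with its exponent. Then $$-\frac{\mathcal D_v'}{\mathcal D_v}(s)=\sum_{\ell=1}^\infty\frac{a_{\mathcal D}(v^\ell)\log q_v}{q_v^{\ell s}}$$ for $\mathrm{Re}(s)$ sufficiently large, so that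 the $a_{\mathcal D}(v^\ell)\log q_v$ are the Dirichlet coefficients of $-\mathcal D'/\mathcal D$ at the powers of $v$; and $a_{\mathcal D}(v^\ell)$ is real with $a_{\mathcal D}(v^\ell)\ge0$ for every $\ell\ge1$. -/

import Mathlib

open MeasureTheory IsDedekindDomain NumberField

noncomputable section

namespace AutRep

/-! ### Local embeddings into the adelic groups -/

/-- A homomorphism `f : R → S` of rings which need not preserve `1` induces the homomorphism
`u ↦ 1 + f (u - 1)` of unit groups. -/
def unitsEmb {R S : Type*} [Ring R] [Ring S] (f : R →ₙ+* S) : Rˣ →* Sˣ where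
  toFun u :=
    { val := 1 + f (u - 1)
      inv := 1 + f ((u⁻¹ : Rˣ) - 1)
      val_inv := by
        have h : (1 + f ((u : R) - 1)) * (1 + f ((u⁻¹ : Rˣ) - 1))
            = 1 + f (((u : R) - 1) + ((u⁻¹ : Rˣ) - 1) + ((u : R) - 1) * ((u⁻¹ : Rˣ) - 1)) := by
          simp only [map_add, map_mul]; noncomm_ring
        rw [h]
        have h' : ((u : R) - 1) + ((u⁻¹ : Rˣ) - 1) + ((u : R) - 1) * ((u⁻¹ : Rˣ) - 1) = 0 := by
          simp only [sub_mul, mul_sub, mul_one, one_mul, Units.mul_inv]; abel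
        rw [h', map_zero, add_zero]
      inv_val := by
        have h : (1 + f ((u⁻¹ : Rˣ) - 1)) * (1 + f ((u : R) - 1))
            = 1 + f (((u⁻¹ : Rˣ) - 1) + ((u : R) - 1) + ((u⁻¹ : Rˣ) - 1) * ((u : R) - 1)) := by
          simp only [map_add, map_mul]; noncomm_ring
        rw [h]
        have h' : ((u⁻¹ : Rˣ) - 1) + ((u : R) - 1) + ((u⁻¹ : Rˣ) - 1) * ((u : R) - 1) = 0 := by
          simp only [sub_mul, mul_sub, mul_one, one_mul, Units.inv_mul]; abel
        rw [h', map_zero, add_zero] }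
  map_one' := by ext; simp
  map_mul' u u' := by
    ext
    have h : (1 + f ((u : R) - 1)) * (1 + f ((u' : R) - 1))
        = 1 + f (((u : R) - 1) + ((u' : R) - 1) + ((u : R) - 1) * ((u' : R) - 1)) := by
      simp only [map_add, map_mul]; noncomm_ring
    have h' : ((u : R) - 1) + ((u' : R) - 1) + ((u : R) - 1) * ((u' : R) - 1)
        = (u : R) * u' - 1 := by
      simp only [sub_mul, mul_sub, mul_one, one_mul]; abel
    simp only [Units.val_mul]
    rw [h, h']

/-- Entrywise application of a (not necessarily unital) ring homomorphism to `2 × 2` matrices. -/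
def matEmb {R S : Type*} [Ring R] [Ring S] (f : R →ₙ+* S) :
    Matrix (Fin 2) (Fin 2) R →ₙ+* Matrix (Fin 2) (Fin 2) S where
  toFun M := M.map f
  map_zero' := by ext; simp
  map_add' M N := by ext; simp
  map_mul' M N := by ext; simp [Matrix.mul_apply]

variable (F : Type*) [Field F] [NumberField F]

/-- The adele ring `𝔸_F` of the number field `F`. -/
abbrev Adele : Type _ := AdeleRing (𝓞 F) F

/-- The idele group `𝔸_F^×`. -/
abbrev Idele : Type _ := (Adele F)ˣ

/-- The topological group `GL₂(𝔸_F)`. -/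
abbrev AdelicGL2 : Type _ := Matrix.GeneralLinearGroup (Fin 2) (Adele F)

/-- `GL₂(𝔸_F)` carries its Borel `σ`-algebra. -/
instance : MeasurableSpace (AdelicGL2 F) := borel _

instance : BorelSpace (AdelicGL2 F) := ⟨rfl⟩

variable {F}

open Classical in
/-- The ring embedding `F_v → 𝔸_F` sending `x` to the adele with component `x` at `v` and all other
components `0`. -/
def adeleAt (v : HeightOneSpectrum (𝓞 F)) : v.adicCompletion F →ₙ+* Adele F where
  toFun x := (0,
    ⟨fun w => if h : w = v then h ▸ x else 0,
      (Set.finite_singleton v).subset fun w hw => by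
        by_contra hne
        exact hw (by
          have hne' : w ≠ v := hne
          simp [hne', zero_mem])⟩)
  map_zero' := by
    refine Prod.ext rfl (FiniteAdeleRing.ext _ fun w => ?_)
    change (if h : w = v then h ▸ (0 : v.adicCompletion F) else 0) = (0 : w.adicCompletion F)
    split_ifs with h
    · subst h; rfl
    · rfl
  map_add' x y := by
    refine Prod.ext (add_zero _).symm (FiniteAdeleRing.ext _ fun w => ?_)
    change (if h : w = v then h ▸ (x + y) else 0) = (if h : w = v then h ▸ x else 0) +
      (if h : w = v then h ▸ y else (0 : w.adicCompletion F))
    split_ifs with h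
    · subst h; rfl
    · simp
  map_mul' x y := by
    refine Prod.ext (mul_zero _).symm (FiniteAdeleRing.ext _ fun w => ?_)
    change (if h : w = v then h ▸ (x * y) else 0) = (if h : w = v then h ▸ x else 0) *
      (if h : w = v then h ▸ y else (0 : w.adicCompletion F))
    split_ifs with h
    · subst h; rfl
    · simp

/-- The embedding `F_v^× → 𝔸_F^×`: component `x` at `v` and `1` at all other places. -/
def ideleAt (v : HeightOneSpectrum (𝓞 F)) : (v.adicCompletion F)ˣ →* Idele F :=
  unitsEmb (adeleAt v)

/-- The embedding `GL₂(F_v) → GL₂(𝔸_F)`: component `h` at `v` and the identity matrix at all other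
places. -/
def gl2At (v : HeightOneSpectrum (𝓞 F)) :
    Matrix.GeneralLinearGroup (Fin 2) (v.adicCompletion F) →* AdelicGL2 F :=
  unitsEmb (matEmb (adeleAt v))

/-- The upper triangular matrix with diagonal `a, d` and upper right entry `b`, in `GL₂(F_v)`. -/
def upperTri {v : HeightOneSpectrum (𝓞 F)} (a d : (v.adicCompletion F)ˣ) (b : v.adicCompletion F) :
    Matrix.GeneralLinearGroup (Fin 2) (v.adicCompletion F) :=
  Matrix.GeneralLinearGroup.mkOfDetNeZero !![(a : v.adicCompletion F), b; 0, d]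
    (by simp [Matrix.det_fin_two])

/-- The cardinality `q_v` of the residue field at `v`. -/
def resCard (v : HeightOneSpectrum (𝓞 F)) : ℕ := Ideal.absNorm v.asIdeal

/-- `ϖ` is a uniformizer of `F_v`. -/
def IsUnif {v : HeightOneSpectrum (𝓞 F)} (ϖ : (v.adicCompletion F)ˣ) : Prop :=
  Valued.v (ϖ : v.adicCompletion F) = WithZero.exp (-1 : ℤ)

variable (F)

/-! ### Unitary idele class characters -/

/-- The set `𝔉₁`: continuous unitary characters of `F^× \ 𝔸_F^×`. -/
structure HeckeChar where
  /-- the character of the idele group -/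
  toHom : Idele F →ₜ* Circle
  /-- triviality on principal ideles -/
  map_principal : ∀ x : Fˣ, toHom (Units.map (algebraMap F (Adele F)).toMonoidHom x) = 1

variable {F}

/-- The value of an idele class character as a complex number. -/
def HeckeChar.val (χ : HeckeChar F) (x : Idele F) : ℂ := (χ.toHom x : ℂ)

/-- `χ` is unramified at the finite place `v`: its local component is trivial on `𝒪_v^×`. -/
def HeckeChar.IsUnramifiedAt (χ : HeckeChar F) (v : HeightOneSpectrum (𝓞 F)) : Prop :=
  ∀ u : (v.adicCompletion F)ˣ, Valued.v (u : v.adicCompletion F) = 1 → χ.val (ideleAt v u) = 1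

variable (F)

/-! ### The space of square-integrable cuspidal functions -/

/-- The subgroup `Z(𝔸_F) GL₂(F)` of `GL₂(𝔸_F)`, with `Z` the group of scalar matrices. -/
def centralRational : Subgroup (AdelicGL2 F) :=
  (Matrix.GeneralLinearGroup.scalar (Fin 2) (R := Adele F)).range ⊔
    (Matrix.GeneralLinearGroup.map (n := Fin 2) (algebraMap F (Adele F))).range

/-- The quotient `Z(𝔸_F) GL₂(F) \ GL₂(𝔸_F)`, with the quotient topology and `σ`-algebra. -/
abbrev AutQuot : Type _ := Quotient (QuotientGroup.rightRel (centralRational F))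

variable {F}

/-- Right translation by `g` on `Z(𝔸_F) GL₂(F) \ GL₂(𝔸_F)`. -/
def rightTranslate (g : AdelicGL2 F) : AutQuot F → AutQuot F :=
  Quotient.map' (fun x => x * g) (fun x y h => by
    rw [QuotientGroup.rightRel_apply] at h ⊢
    simpa [mul_assoc] using h)

/-- `μ` is a non-zero measure on `Z(𝔸_F) GL₂(F) \ GL₂(𝔸_F)`, finite on compact sets and invariant
under right translation by `GL₂(𝔸_F)`. It is unique up to a positive scalar. -/
structure IsInvariantMeasure (μ : Measure (AutQuot F)) : Prop where
  ne_zero : μ ≠ 0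
  finite_compact : ∀ C : Set (AutQuot F), IsCompact C → μ C < ⊤
  map_eq : ∀ g : AdelicGL2 F, μ.map (rightTranslate g) = μ

/-- The square `∫ |φ|² dμ` of the `L²`-seminorm, for a function `φ` on `GL₂(𝔸_F)` whose absolute value
is left invariant under `Z(𝔸_F) GL₂(F)`. -/
def sqNorm (μ : Measure (AutQuot F)) (φ : AdelicGL2 F → ℂ) : ENNReal :=
  ∫⁻ x : AutQuot F, ‖φ x.out‖ₑ ^ 2 ∂μ

/-- Right translation of functions: `(R(h) φ)(g) = φ(g h)`. -/
def rightReg (h : AdelicGL2 F) (φ : AdelicGL2 F → ℂ) : AdelicGL2 F → ℂ := fun g => φ (g * h)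

variable (F)

/-- The compact group `F \ 𝔸_F`. -/
abbrev AdeleModF : Type _ := Adele F ⧸ AdeleRing.principalSubgroup (𝓞 F) F

/-- `F \ 𝔸_F` carries its Borel `σ`-algebra. -/
instance : MeasurableSpace (AdeleModF F) := borel _

variable {F}

/-- `φ` is a cuspidal function in `L²(GL₂(F) \ GL₂(𝔸_F), ω)`. The vanishing of the constant term
`∫_{F \ 𝔸_F} φ(n(x) g) dx`, with `n(x)` the upper triangular unipotent matrix with entry `x`, holds for
almost every `g` with respect to Haar measure. (Two such functions `φ, φ'` are the same element of
the Hilbert space when `sqNorm μ (φ - φ') = 0`.) -/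
structure IsCuspidalL2 (μ : Measure (AutQuot F)) (ω : HeckeChar F) (φ : AdelicGL2 F → ℂ) :
    Prop where
  measurable : Measurable φ
  left_invariant : ∀ (γ : Matrix.GeneralLinearGroup (Fin 2) F) (g : AdelicGL2 F),
    φ (Matrix.GeneralLinearGroup.map (algebraMap F (Adele F)) γ * g) = φ g
  central : ∀ (z : Idele F) (g : AdelicGL2 F),
    φ (Matrix.GeneralLinearGroup.scalar (Fin 2) z * g) = ω.val z * φ g
  square_integrable : sqNorm μ φ < ⊤
  cuspidal : ∀ (ν : Measure (AdeleModF F)) (m : Measure (AdelicGL2 F)),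
    ν.IsAddHaarMeasure → m.IsHaarMeasure → ∀ᵐ g ∂m,
      Integrable (fun x : AdeleModF F =>
        φ (Matrix.GeneralLinearGroup.upperRightHom x.out * g)) ν ∧
      ∫ x : AdeleModF F,
        φ (Matrix.GeneralLinearGroup.upperRightHom x.out * g) ∂ν = 0

/-- `V` is (the full preimage, in the space of functions, of) a closed subspace of the Hilbert space of
cuspidal `L²`-functions with central character `ω`, invariant under right translation. -/
structure IsClosedInvariant (μ : Measure (AutQuot F)) (ω : HeckeChar F)
    (V : Submodule ℂ (AdelicGL2 F → ℂ)) : Prop where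
  isCuspidalL2 : ∀ φ ∈ V, IsCuspidalL2 μ ω φ
  closed : ∀ φ, IsCuspidalL2 μ ω φ →
    (∀ ε : ENNReal, 0 < ε → ∃ ψ ∈ V, sqNorm μ (φ - ψ) < ε) → φ ∈ V
  invariant : ∀ h : AdelicGL2 F, ∀ φ ∈ V, rightReg h φ ∈ V

/-- The set `𝔉₂`: cuspidal automorphic representations of `GL₂(𝔸_F)` with unitary central character,
i.e. irreducible closed invariant subspaces of the cuspidal part of `L²(GL₂(F) \ GL₂(𝔸_F), ω)`. -/
structure CuspRep (μ : Measure (AutQuot F)) where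
  /-- the central character -/
  centralChar : HeckeChar F
  /-- the space of the representation -/
  space : Submodule ℂ (AdelicGL2 F → ℂ)
  isClosedInvariant : IsClosedInvariant μ centralChar space
  nonzero : ∃ φ ∈ space, sqNorm μ φ ≠ 0
  irreducible : ∀ W ≤ space, IsClosedInvariant μ centralChar W →
    (∀ φ ∈ W, sqNorm μ φ = 0) ∨ W = space

/-- `π ∼ π'`: there is `ψ` in `𝔉₁` with `π' = π ⊗ ψ`, where `π ⊗ ψ` is realised on the functions
`g ↦ ψ(det g) φ(g)`. -/
def TwistEquivalent {μ : Measure (AutQuot F)} (π π' : CuspRep μ) : Prop :=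
  ∃ ψ : HeckeChar F, (π'.space : Set (AdelicGL2 F → ℂ)) =
    (fun (φ : AdelicGL2 F → ℂ) (g : AdelicGL2 F) =>
      ψ.val (Matrix.GeneralLinearGroup.det g) * φ g) '' (π.space : Set (AdelicGL2 F → ℂ))

/-! ### Unramified places and Satake parameters -/

/-- `φ` is a non-zero vector of `π` fixed by `GL₂(𝒪_v)`. -/
structure IsSpherical {μ : Measure (AutQuot F)} (π : CuspRep μ) (v : HeightOneSpectrum (𝓞 F))
    (φ : AdelicGL2 F → ℂ) : Prop where
  mem : φ ∈ π.space
  nonzero : sqNorm μ φ ≠ 0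
  fixed : ∀ k : Matrix.GeneralLinearGroup (Fin 2) (v.adicCompletionIntegers F),
    sqNorm μ (rightReg (gl2At v (Matrix.GeneralLinearGroup.map
      (algebraMap (v.adicCompletionIntegers F) (v.adicCompletion F)) k)) φ - φ) = 0

/-- `π` is unramified at the finite place `v`, i.e. `v` is not in `S_π`. -/
def CuspRep.IsUnramifiedAt {μ : Measure (AutQuot F)} (π : CuspRep μ)
    (v : HeightOneSpectrum (𝓞 F)) : Prop :=
  ∃ φ, IsSpherical π v φ

/-- The action on `GL₂(𝒪_v)`-fixed functions of the characteristic function of the double coset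
`K diag(ϖ, 1) K`, `K = GL₂(𝒪_v)` of volume `1`. That double coset is the disjoint union of the left cosets
of `K` represented by the matrices `[ϖ, b; 0, 1]`, `b` modulo `v`, and `[1, 0; 0, ϖ]`. -/
def heckeT (v : HeightOneSpectrum (𝓞 F)) (ϖ : (v.adicCompletion F)ˣ) (φ : AdelicGL2 F → ℂ) :
    AdelicGL2 F → ℂ := fun g =>
  (∑ᶠ b : 𝓞 F ⧸ v.asIdeal,
    φ (g * gl2At v (upperTri ϖ 1 ((algebraMap (𝓞 F) F b.out : F) : v.adicCompletion F))))
  + φ (g * gl2At v (upperTri 1 ϖ 0))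

/-- `α` is the pair of Satake parameters `α₁, α₂` of `π` at the unramified place `v`: on a non-zero
`GL₂(𝒪_v)`-fixed vector of `π` (equivalently on all of them, since the spherical Hecke algebra at `v`
acts on them by scalars) the double cosets of `diag(ϖ, 1)` and `diag(ϖ, ϖ)` act by
`q_v^{1/2} (α₁ + α₂)` and by `α₁ α₂`. -/
def CuspRep.IsSatakeParameters {μ : Measure (AutQuot F)} (π : CuspRep μ)
    (v : HeightOneSpectrum (𝓞 F)) (ϖ : (v.adicCompletion F)ˣ) (α : Fin 2 → ℂ) : Prop :=
  ∃ φ, IsSpherical π v φ ∧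
    sqNorm μ (heckeT v ϖ φ - ((Real.sqrt (resCard v) : ℂ) * (α 0 + α 1)) • φ) = 0 ∧
    sqNorm μ (rightReg (gl2At v (upperTri ϖ ϖ 0)) φ - (α 0 * α 1) • φ) = 0

/-! ### Unramified Euler factors -/

/-- The Euler factor `∏ (1 - α q^{-s})⁻¹` with (multi)set of local parameters `A`. -/
def localL (q : ℕ) (A : Multiset ℂ) (s : ℂ) : ℂ :=
  (A.map fun α => (1 - α * (q : ℂ) ^ (-s))⁻¹).prod

/-- The coefficient `a(v^ℓ) = ∑ α^ℓ`. -/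
def coeffA (A : Multiset ℂ) (ℓ : ℕ) : ℂ := (A.map fun α => α ^ ℓ).sum

/-- Parameters of the `m`-th symmetric power. -/
def symPow (m : ℕ) (α : Fin 2 → ℂ) : Multiset ℂ :=
  (Multiset.range (m + 1)).map fun j => α 0 ^ j * α 1 ^ (m - j)

/-- Parameters of the twist by a character with local parameter `c`. -/
def twist (A : Multiset ℂ) (c : ℂ) : Multiset ℂ := A.map fun α => α * c

/-- Parameters of a Rankin--Selberg convolution. -/
def rankinSelberg (A B : Multiset ℂ) : Multiset ℂ := (A ×ˢ B).map fun p => p.1 * p.2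

/-- The factors of `𝒟`, locally at a place where everything is unramified: a list of pairs
(exponent, local parameters). Here `α, α'` are the Satake parameters of `π, π'` and `w, w', c` are
the values at `ϖ` of the characters `ω_π, ω_π', χ`. -/
def factorsD (α α' : Fin 2 → ℂ) (w w' c : ℂ) : List (ℕ × Multiset ℂ) :=
  let conj : ℂ → ℂ := starRingEnd ℂ
  let Ad := twist (symPow 2 α) (conj w)
  let Ad' := twist (symPow 2 α') (conj w')
  [ (6, {1}),
    (4, rankinSelberg Ad (twist Ad' c)),
    (4, rankinSelberg Ad (twist Ad' (conj c))),
    (7, Ad),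
    (2, Ad'),
    (2, twist Ad' c),
    (2, twist Ad' (conj c)),
    (5, twist (symPow 4 α) (conj w ^ 2)),
    (2, twist (symPow 4 α') (conj w' ^ 2)),
    (3, rankinSelberg Ad Ad'),
    (3, rankinSelberg Ad (twist (symPow 4 α') (conj w' ^ 2))),
    (1, rankinSelberg Ad' (twist (symPow 4 α) (conj w ^ 2))),
    (2, rankinSelberg Ad' (twist (symPow 4 α) (c * conj w ^ 2))),
    (2, rankinSelberg Ad' (twist (symPow 4 α) (conj c * conj w ^ 2))),
    (1, rankinSelberg (symPow 4 α) (twist (symPow 4 α') (conj w ^ 2 * conj w' ^ 2))) ]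

/-- The Euler factor at `v` of a product of `L`-functions. -/
def eulerD (q : ℕ) (D : List (ℕ × Multiset ℂ)) (s : ℂ) : ℂ :=
  (D.map fun p => localL q p.2 s ^ p.1).prod

/-- The coefficient `a_D(v^ℓ)` of a product of `L`-functions. -/
def coeffD (D : List (ℕ × Multiset ℂ)) (ℓ : ℕ) : ℂ :=
  (D.map fun p => (p.1 : ℂ) * coeffA p.2 ℓ).sum

end AutRep

end

/-! On power sums, twists and Rankin–Selberg products become products, so `a_𝒟(v^ℓ)` is a polynomial
in the power sums of `Ad`, `Sym⁴` and the character values. Let `A`, `A'` be the coefficients of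
`Ad(π)`, `Ad(π')` and `C = χ_v(ϖ)^ℓ`. Clebsch–Gordan, `Ad ⊗ Ad = 1 + Ad + Sym⁴ ⊗ ω̄²`, eliminates
both `Sym⁴` terms. Since `A`, `A'` are real and `|C| = 1`, the polynomial is then `|2A + C A' (1 +
A)|²` (`coeffD_factorsD`): `𝒟` is built as the Rankin–Selberg square of `2 Ad(π) + Ad(π') ⊗ χ +
Ad(π) × (Ad(π') ⊗ χ)`.

Reality of `A` needs no Ramanujan bound, only unitarity: `α₁α₂ = w` and `α₁ + α₂ = w · conj (α₁ +
α₂)` with `|w| = 1` (`IsUnitaryPair`). These relations come from the inner product on `π`. For a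
spherical vector `φ`, the coefficient `⟨R(g)φ, φ⟩` depends only on the double coset of `g`, and
`diag(ϖ,1)⁻¹` lies, up to the centre, in the double coset of `diag(ϖ,1)`. Hence `⟨Tφ, φ⟩ = w · conj
⟨Tφ, φ⟩` (`pairing_heckeT_eq`). -/

namespace AutRep

open scoped ComplexConjugate

/-! ### Power sums of local parameters -/

lemma coeffA_zero (ℓ : ℕ) : coeffA 0 ℓ = 0 := by simp [coeffA]

lemma coeffA_cons (a : ℂ) (A : Multiset ℂ) (ℓ : ℕ) :
    coeffA (a ::ₘ A) ℓ = a ^ ℓ + coeffA A ℓ := by simp [coeffA]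

lemma coeffA_add (A B : Multiset ℂ) (ℓ : ℕ) :
    coeffA (A + B) ℓ = coeffA A ℓ + coeffA B ℓ := by simp [coeffA]

lemma coeffA_singleton (a : ℂ) (ℓ : ℕ) : coeffA {a} ℓ = a ^ ℓ := by simp [coeffA]

lemma coeffA_twist (A : Multiset ℂ) (c : ℂ) (ℓ : ℕ) :
    coeffA (twist A c) ℓ = coeffA A ℓ * c ^ ℓ := by
  simp [coeffA, twist, mul_pow, Multiset.sum_map_mul_right]

lemma coeffA_rankinSelberg (A B : Multiset ℂ) (ℓ : ℕ) :
    coeffA (rankinSelberg A B) ℓ = coeffA A ℓ * coeffA B ℓ := by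
  induction A using Multiset.induction_on with
  | empty => simp [rankinSelberg, coeffA]
  | cons a A ih =>
    have h : rankinSelberg (a ::ₘ A) B = B.map (a * ·) + rankinSelberg A B := by
      simp [rankinSelberg, Multiset.cons_product]
    rw [h, coeffA_add, ih, coeffA_cons, add_mul]
    simp [coeffA, mul_pow, Multiset.sum_map_mul_left]

lemma coeffA_symPow (m : ℕ) (α : Fin 2 → ℂ) (ℓ : ℕ) :
    coeffA (symPow m α) ℓ =
      ∑ j ∈ Finset.range (m + 1), (α 0 ^ ℓ) ^ j * (α 1 ^ ℓ) ^ (m - j) := by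
  simp only [coeffA, symPow, Multiset.map_map, Finset.sum, Finset.range_val, Function.comp_def,
    mul_pow, ← pow_mul]
  simp only [mul_comm]

/-! ### Satake parameters of unitary representations -/

/-- The pair `{α₁, α₂}` of Satake parameters satisfies the symmetry of a representation with unitary
central character taking the value `w` at a uniformizer. -/
structure IsUnitaryPair (α : Fin 2 → ℂ) (w : ℂ) : Prop where
  norm_eq : w * conj w = 1
  prod_eq : α 0 * α 1 = w
  sum_eq : α 0 + α 1 = w * conj (α 0 + α 1)

namespace IsUnitaryPair

variable {α : Fin 2 → ℂ} {w : ℂ}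

/-- By the relations, `conj α₁` is a root of `w X² - (α₁ + α₂) X + 1 = (α₁ X - 1)(α₂ X - 1)`. The
two alternatives are the tempered and the complementary series shapes. -/
lemma conj_eq (h : IsUnitaryPair α w) :
    (α 0 * conj (α 0) = 1 ∧ α 1 * conj (α 1) = 1) ∨
      (α 0 * conj (α 1) = 1 ∧ α 1 * conj (α 0) = 1) := by
  obtain ⟨h1, h2, h3⟩ := h
  have hw : w ≠ 0 := left_ne_zero_of_mul_eq_one h1
  have h2' : conj (α 0) * conj (α 1) = conj w := by rw [← h2, map_mul]
  rw [map_add] at h3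
  have h0 : α 0 ≠ 0 := by rintro h; simp [h] at h2; exact hw h2.symm
  have h01 : α 1 ≠ 0 := by rintro h; simp [h] at h2; exact hw h2.symm
  have key : (α 0 * conj (α 0) - 1) * (α 1 * conj (α 0) - 1) = 0 := by
    linear_combination (conj (α 0)) ^ 2 * h2 - conj (α 0) * h3 - w * h2' - h1
  rcases mul_eq_zero.1 key with h | h
  · left
    have h : α 0 * conj (α 0) = 1 := by linear_combination h
    refine ⟨h, ?_⟩
    linear_combination h1 - α 1 * conj (α 1) * h + w * h2' + conj (α 0) * conj (α 1) * h2
  · right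
    have h : α 1 * conj (α 0) = 1 := by linear_combination h
    refine ⟨?_, h⟩
    linear_combination h1 - α 0 * conj (α 1) * h + w * h2' + conj (α 0) * conj (α 1) * h2

/-- Both alternatives of `conj_eq` survive taking powers; this reduces every later identity to the
case `ℓ = 1`. -/
lemma pow (h : IsUnitaryPair α w) (ℓ : ℕ) : IsUnitaryPair (fun i => α i ^ ℓ) (w ^ ℓ) where
  norm_eq := by rw [map_pow, ← mul_pow, h.norm_eq, one_pow]
  prod_eq := by rw [← mul_pow, h.prod_eq]
  sum_eq := by
    simp only [← h.prod_eq, map_add, map_pow, mul_pow]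
    rcases h.conj_eq with ⟨h0, h1⟩ | ⟨h0, h1⟩
    · have h0 : α 0 ^ ℓ * conj (α 0) ^ ℓ = 1 := by rw [← mul_pow, h0, one_pow]
      have h1 : α 1 ^ ℓ * conj (α 1) ^ ℓ = 1 := by rw [← mul_pow, h1, one_pow]
      linear_combination -α 1 ^ ℓ * h0 - α 0 ^ ℓ * h1
    · have h0 : α 0 ^ ℓ * conj (α 1) ^ ℓ = 1 := by rw [← mul_pow, h0, one_pow]
      have h1 : α 1 ^ ℓ * conj (α 0) ^ ℓ = 1 := by rw [← mul_pow, h1, one_pow]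
      linear_combination -α 1 ^ ℓ * h0 - α 0 ^ ℓ * h1

/-- The coefficients of `Ad(π)` are real. -/
lemma conj_coeffA_ad (h : IsUnitaryPair α w) (ℓ : ℕ) :
    conj (coeffA (symPow 2 α) ℓ * conj w ^ ℓ) = coeffA (symPow 2 α) ℓ * conj w ^ ℓ := by
  obtain ⟨h1, h2, h3⟩ := h.pow ℓ
  have h2' := congrArg conj h2
  rw [coeffA_symPow]
  simp only [Finset.sum_range_succ, Finset.sum_range_zero, map_add, map_mul, map_pow,
    Complex.conj_conj, pow_zero, pow_one] at *
  generalize α 0 ^ ℓ = P at *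
  generalize α 1 ^ ℓ = Q at *
  generalize conj (α 0) ^ ℓ = P' at *
  generalize conj (α 1) ^ ℓ = Q' at *
  generalize w ^ ℓ = W at *
  generalize conj w ^ ℓ = W' at *
  norm_num
  -- With `S = P + Q`, the relation `S = W · conj S` gives `W' S² = |S|²`, so the coefficient is
  -- `|S|² - 1`.
  linear_combination (-(P' + Q') ^ 2 * W) * h1 - W * h2' + W' * h2
    - W' * (P + Q + W * (P' + Q')) * h3

/-- The coefficients of `Sym⁴(π) ⊗ ω̄²` in terms of those of `Ad(π)`. -/
lemma coeffA_symPow_four (h : IsUnitaryPair α w) (ℓ : ℕ) :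
    coeffA (symPow 4 α) ℓ * (conj w ^ 2) ^ ℓ =
      (coeffA (symPow 2 α) ℓ * conj w ^ ℓ) ^ 2 - coeffA (symPow 2 α) ℓ * conj w ^ ℓ - 1 := by
  obtain ⟨h1, h2, -⟩ := h.pow ℓ
  rw [coeffA_symPow, coeffA_symPow, ← pow_mul, mul_comm 2 ℓ, pow_mul]
  simp only [Finset.sum_range_succ, Finset.sum_range_zero, map_pow] at *
  generalize α 0 ^ ℓ = P at *
  generalize α 1 ^ ℓ = Q at *
  generalize conj w ^ ℓ = W' at *
  norm_num
  have h3 : P * Q * W' = 1 := by rw [h2, h1]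
  -- This is Clebsch–Gordan for `Ad ⊗ Ad`, with `P Q W' = 1` absorbing the difference of degrees.
  linear_combination ((P ^ 2 + P * Q + Q ^ 2) * W' + (1 + P * Q * W')) * (-h3)

end IsUnitaryPair

/-- With `A, A'` the coefficients of `Ad(π), Ad(π')` and `C` that of `χ`, the coefficient of `𝒟` is
`|2 A + C A' (1 + A)|²`. -/
lemma coeffD_factorsD {α α' : Fin 2 → ℂ} {w w' c : ℂ} (h : IsUnitaryPair α w)
    (h' : IsUnitaryPair α' w') (hc : c * conj c = 1) (ℓ : ℕ) :
    coeffD (factorsD α α' w w' c) ℓ =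
      Complex.normSq (2 * (coeffA (symPow 2 α) ℓ * conj w ^ ℓ) +
        c ^ ℓ * (coeffA (symPow 2 α') ℓ * conj w' ^ ℓ) *
          (1 + coeffA (symPow 2 α) ℓ * conj w ^ ℓ)) := by
  have hA := h.conj_coeffA_ad ℓ
  have hA' := h'.conj_coeffA_ad ℓ
  have hS := h.coeffA_symPow_four ℓ
  have hS' := h'.coeffA_symPow_four ℓ
  have hC : c ^ ℓ * conj c ^ ℓ = 1 := by rw [← mul_pow, hc, one_pow]
  rw [Complex.normSq_eq_conj_mul_self]
  simp only [coeffD, factorsD, List.map_cons, List.map_nil, List.sum_cons, List.sum_nil,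
    coeffA_rankinSelberg, coeffA_twist, coeffA_singleton, one_pow, map_add, map_mul (starRingEnd ℂ),
    map_one, Complex.conj_ofNat, mul_pow _ _ ℓ, map_pow, Complex.conj_conj] at *
  rw [hA, hA']
  generalize coeffA (symPow 2 α) ℓ * conj w ^ ℓ = A at *
  generalize coeffA (symPow 2 α') ℓ * conj w' ^ ℓ = A' at *
  generalize coeffA (symPow 4 α) ℓ = S at *
  generalize coeffA (symPow 4 α') ℓ = S' at *
  generalize (conj w ^ 2) ^ ℓ = W at *
  generalize (conj w' ^ 2) ^ ℓ = W' at *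
  generalize c ^ ℓ = C at *
  generalize conj c ^ ℓ = C' at *
  push_cast
  -- The multipliers are the cofactors of the two `Sym⁴` terms in the coefficient of `𝒟`; in the
  -- first one the term of `π'` is already replaced by `A'² - A' - 1`.
  linear_combination (5 + A' + 2 * A' * C + 2 * A' * C' + (A' ^ 2 - A' - 1)) * hS
    + (2 + 3 * A + S * W) * hS' - (A' * (1 + A)) ^ 2 * hC

/-! ### Logarithmic derivatives of Euler factors -/

/-- Geometric series. Differentiability and non-vanishing are carried along because additivity of
`logDeriv` over products requires them. The index `ℓ + 1` reflects that the Dirichlet series starts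
at `ℓ = 1`. -/
lemma hasSum_logDeriv_eulerFactor {q : ℕ} (hq : 0 < q) {a s : ℂ}
    (h : ‖a * (q : ℂ) ^ (-s)‖ < 1) :
    DifferentiableAt ℂ (fun s : ℂ => (1 - a * (q : ℂ) ^ (-s))⁻¹) s ∧
    (1 - a * (q : ℂ) ^ (-s))⁻¹ ≠ 0 ∧
    HasSum (fun ℓ : ℕ => a ^ (ℓ + 1) * (Real.log q : ℂ) * (q : ℂ) ^ (-((ℓ + 1 : ℕ) : ℂ) * s))
      (-logDeriv (fun s : ℂ => (1 - a * (q : ℂ) ^ (-s))⁻¹) s) := by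
  have hq' : (q : ℂ) ≠ 0 := by exact_mod_cast hq.ne'
  have hne : 1 - a * (q : ℂ) ^ (-s) ≠ 0 := by
    intro h0
    rw [← sub_eq_zero.1 h0, norm_one] at h
    exact lt_irrefl _ h
  have hd : HasDerivAt (fun s : ℂ => 1 - a * (q : ℂ) ^ (-s))
      (a * ((q : ℂ) ^ (-s) * Complex.log q)) s := by
    have := (((hasDerivAt_id s).neg.const_cpow (c := (q : ℂ)) (Or.inl hq')).const_mul a).const_sub 1
    simpa using this
  refine ⟨(hd.inv hne).differentiableAt, inv_ne_zero hne, ?_⟩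
  have hlog : logDeriv (fun s : ℂ => (1 - a * (q : ℂ) ^ (-s))⁻¹) s =
      -(a * ((q : ℂ) ^ (-s) * Complex.log q) * (1 - a * (q : ℂ) ^ (-s))⁻¹) := by
    rw [logDeriv_apply, (hd.fun_inv hne).deriv]
    field_simp
  rw [hlog, neg_neg]
  have hg := (hasSum_geometric_of_norm_lt_one h).mul_left (a * ((q : ℂ) ^ (-s) * Complex.log q))
  refine HasSum.congr_fun hg fun ℓ => ?_
  rw [← Complex.natCast_log, show -((ℓ + 1 : ℕ) : ℂ) * s = ((ℓ + 1 : ℕ) : ℂ) * (-s) by ring,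
    Complex.cpow_nat_mul]
  ring

lemma hasSum_logDeriv_localL {q : ℕ} (hq : 0 < q) (A : Multiset ℂ) {s : ℂ}
    (h : ∀ a ∈ A, ‖a * (q : ℂ) ^ (-s)‖ < 1) :
    DifferentiableAt ℂ (localL q A) s ∧ localL q A s ≠ 0 ∧
    HasSum (fun ℓ : ℕ =>
        coeffA A (ℓ + 1) * (Real.log q : ℂ) * (q : ℂ) ^ (-((ℓ + 1 : ℕ) : ℂ) * s))
      (-logDeriv (localL q A) s) := by
  induction A using Multiset.induction_on with
  | empty =>
    have : localL q 0 = fun _ => 1 := by ext; simp [localL]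
    rw [this]
    refine ⟨by fun_prop, one_ne_zero, ?_⟩
    simp [coeffA_zero, logDeriv_const, hasSum_zero]
  | cons a A ih =>
    obtain ⟨d1, n1, s1⟩ := ih fun b hb => h b (Multiset.mem_cons_of_mem hb)
    obtain ⟨d2, n2, s2⟩ := hasSum_logDeriv_eulerFactor hq (h a (Multiset.mem_cons_self a A))
    have : localL q (a ::ₘ A) = fun s => (1 - a * (q : ℂ) ^ (-s))⁻¹ * localL q A s := by
      ext; simp [localL]
    rw [this]
    refine ⟨d2.fun_mul d1, mul_ne_zero n2 n1, ?_⟩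
    rw [logDeriv_mul s n2 n1 d2 d1, neg_add]
    refine HasSum.congr_fun (s2.add s1) fun ℓ => ?_
    rw [coeffA_cons]; ring

lemma hasSum_logDeriv_eulerD {q : ℕ} (hq : 0 < q) (D : List (ℕ × Multiset ℂ)) {s : ℂ}
    (h : ∀ p ∈ D, ∀ a ∈ p.2, ‖a * (q : ℂ) ^ (-s)‖ < 1) :
    DifferentiableAt ℂ (eulerD q D) s ∧ eulerD q D s ≠ 0 ∧
    HasSum (fun ℓ : ℕ =>
        coeffD D (ℓ + 1) * (Real.log q : ℂ) * (q : ℂ) ^ (-((ℓ + 1 : ℕ) : ℂ) * s))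
      (-logDeriv (eulerD q D) s) := by
  induction D with
  | nil =>
    have : eulerD q [] = fun _ => 1 := by ext; simp [eulerD]
    rw [this]
    refine ⟨by fun_prop, one_ne_zero, ?_⟩
    simp [coeffD, logDeriv_const, hasSum_zero]
  | cons p D ih =>
    obtain ⟨d1, n1, s1⟩ := ih fun b hb => h b (List.mem_cons_of_mem _ hb)
    obtain ⟨d2, n2, s2⟩ := hasSum_logDeriv_localL hq p.2 (h p List.mem_cons_self)
    have : eulerD q (p :: D) = fun s => localL q p.2 s ^ p.1 * eulerD q D s := by
      ext; simp [eulerD]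
    rw [this]
    have n2' : localL q p.2 s ^ p.1 ≠ 0 := pow_ne_zero _ n2
    refine ⟨(d2.fun_pow _).fun_mul d1, mul_ne_zero n2' n1, ?_⟩
    rw [logDeriv_mul s n2' n1 (d2.fun_pow _) d1, logDeriv_fun_pow d2, neg_add, ← mul_neg]
    refine HasSum.congr_fun ((s2.mul_left (p.1 : ℂ)).add s1) fun ℓ => ?_
    simp only [coeffD, List.map_cons, List.sum_cons]; ring

lemma exists_forall_norm_mul_cpow_lt_one {q : ℕ} (hq : 1 < q) (A : List ℂ) :
    ∃ σ₀ : ℝ, ∀ s : ℂ, σ₀ < s.re → ∀ a ∈ A, ‖a * (q : ℂ) ^ (-s)‖ < 1 := by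
  have hq0 : (0 : ℝ) < q := by positivity
  induction A with
  | nil => exact ⟨0, by simp⟩
  | cons a A ih =>
    obtain ⟨σ, hσ⟩ := ih
    -- The added `1` keeps the argument of the logarithm positive when `a = 0`.
    refine ⟨max σ (Real.logb q (‖a‖ + 1)), fun s hs b hb => ?_⟩
    rcases List.mem_cons.1 hb with rfl | hb
    · have h1 : ‖b‖ + 1 < (q : ℝ) ^ s.re :=
        (Real.logb_lt_iff_lt_rpow (by exact_mod_cast hq) (by positivity)).1
          ((le_max_right _ _).trans_lt hs)
      rw [norm_mul, Complex.norm_natCast_cpow_of_pos (by omega), Complex.neg_re,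
        Real.rpow_neg hq0.le, ← div_eq_mul_inv, div_lt_one (by positivity)]
      linarith
    · exact hσ s ((le_max_left _ _).trans_lt hs) b hb

lemma exists_hasSum_logDeriv_eulerD {q : ℕ} (hq : 1 < q) (D : List (ℕ × Multiset ℂ)) :
    ∃ σ₀ : ℝ, ∀ s : ℂ, σ₀ < s.re →
      HasSum (fun ℓ : ℕ =>
          coeffD D (ℓ + 1) * (Real.log q : ℂ) * (q : ℂ) ^ (-((ℓ + 1 : ℕ) : ℂ) * s))
        (-logDeriv (eulerD q D) s) := by
  obtain ⟨σ₀, h⟩ := exists_forall_norm_mul_cpow_lt_one hq (D.flatMap fun p => p.2.toList)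
  refine ⟨σ₀, fun s hs => (hasSum_logDeriv_eulerD (by omega) D fun p hp a ha => h s hs a ?_).2.2⟩
  exact List.mem_flatMap.2 ⟨p, hp, Multiset.mem_toList.2 ha⟩

variable {F : Type*} [Field F] [NumberField F]

/-! ### The invariant pairing on automorphic functions -/

lemma HeckeChar.val_mul_conj (χ : HeckeChar F) (x : Idele F) : χ.val x * conj (χ.val x) = 1 := by
  rw [HeckeChar.val, ← Circle.coe_inv_eq_conj, ← Circle.coe_mul, mul_inv_cancel, Circle.coe_one]

/-- A function on `GL₂(𝔸_F)` which is left invariant under `Z(𝔸_F) GL₂(F)`. -/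
def IsLeftInvariant {X : Type*} (f : AdelicGL2 F → X) : Prop :=
  ∀ h ∈ centralRational F, ∀ g, f (h * g) = f g

lemma isLeftInvariant_of_scalar_of_rational {X : Type*} {f : AdelicGL2 F → X}
    (hs : ∀ z g, f (Matrix.GeneralLinearGroup.scalar (Fin 2) z * g) = f g)
    (hr : ∀ γ g, f (Matrix.GeneralLinearGroup.map (algebraMap F (Adele F)) γ * g) = f g) :
    IsLeftInvariant f := by
  -- The left periods of `f` form a subgroup, so generators suffice.
  let H : Subgroup (AdelicGL2 F) :=
    { carrier := {h | ∀ g, f (h * g) = f g}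
      one_mem' := fun g => by rw [one_mul]
      mul_mem' := fun {a b} ha hb g => by rw [mul_assoc, ha, hb]
      inv_mem' := fun {a} ha g => by rw [← ha (a⁻¹ * g), mul_inv_cancel_left] }
  have hle : centralRational F ≤ H := by
    refine sup_le ?_ ?_
    · rintro _ ⟨z, rfl⟩
      exact hs z
    · rintro _ ⟨γ, rfl⟩
      exact hr γ
  exact fun h hh => hle hh

namespace IsLeftInvariant

variable {X : Type*} {f : AdelicGL2 F → X}

lemma apply_out_mk (hf : IsLeftInvariant f) (g : AdelicGL2 F) :
    f (Quotient.mk'' g : AutQuot F).out = f g := by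
  have h : (QuotientGroup.rightRel (centralRational F)) (Quotient.mk'' g : AutQuot F).out g :=
    Quotient.mk_out g
  rw [QuotientGroup.rightRel_apply] at h
  rw [← hf _ h, inv_mul_cancel_right]

lemma apply_out_rightTranslate (hf : IsLeftInvariant f) (g : AdelicGL2 F) (x : AutQuot F) :
    f (rightTranslate g x).out = f (x.out * g) := by
  conv_lhs => rw [← Quotient.out_eq' x]
  exact hf.apply_out_mk _

/-- `Quotient.out` is an arbitrary choice, with no measurability of its own; invariance of `f` makes
the choice irrelevant. -/
lemma measurable_out [MeasurableSpace X] (hf : IsLeftInvariant f) (hm : Measurable f) :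
    Measurable fun x : AutQuot F => f x.out := by
  rw [measurable_from_quotient]
  convert hm using 1
  ext g
  exact hf.apply_out_mk g

end IsLeftInvariant

lemma measurable_rightTranslate (g : AdelicGL2 F) :
    Measurable (rightTranslate g : AutQuot F → AutQuot F) := by
  rw [measurable_from_quotient]
  have h : Measurable fun x : AdelicGL2 F => x * g := (continuous_mul_const g).measurable
  exact measurable_quotient_mk''.comp h

variable {μ : Measure (AutQuot F)} {ω : HeckeChar F} {φ ψ φ' : AdelicGL2 F → ℂ}

/-- `φ` alone transforms by `ω` under the centre and does not descend to the quotient. In the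
product the factors `ω(z)` and `conj ω(z)` cancel, so all measurability goes through such products.
-/
lemma IsCuspidalL2.isLeftInvariant_mul_conj (hφ : IsCuspidalL2 μ ω φ) (hψ : IsCuspidalL2 μ ω ψ) :
    IsLeftInvariant fun g => φ g * conj (ψ g) := by
  refine isLeftInvariant_of_scalar_of_rational (fun z g => ?_) fun γ g => ?_
  · simp only [hφ.central, hψ.central, map_mul]
    linear_combination φ g * conj (ψ g) * ω.val_mul_conj z
  · simp only [hφ.left_invariant, hψ.left_invariant]

lemma IsCuspidalL2.measurable_mul_conj_out (hφ : IsCuspidalL2 μ ω φ) (hψ : IsCuspidalL2 μ ω ψ) :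
    Measurable fun x : AutQuot F => φ x.out * conj (ψ x.out) :=
  (hφ.isLeftInvariant_mul_conj hψ).measurable_out
    (hφ.measurable.mul (Complex.continuous_conj.measurable.comp hψ.measurable))

lemma IsCuspidalL2.measurable_norm_sq_out (hφ : IsCuspidalL2 μ ω φ) :
    Measurable fun x : AutQuot F => ‖φ x.out‖ ^ 2 := by
  have h := (hφ.measurable_mul_conj_out hφ).norm
  simpa only [norm_mul, RCLike.norm_conj, ← sq] using h

lemma enorm_norm_sq (z : ℂ) : ‖‖z‖ ^ 2‖ₑ = ‖z‖ₑ ^ 2 := by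
  rw [enorm_pow, enorm_norm]

lemma IsCuspidalL2.integrable_norm_sq_out (hφ : IsCuspidalL2 μ ω φ) :
    Integrable (fun x : AutQuot F => ‖φ x.out‖ ^ 2) μ := by
  refine ⟨hφ.measurable_norm_sq_out.aestronglyMeasurable, ?_⟩
  rw [HasFiniteIntegral]
  simpa only [enorm_norm_sq, sqNorm] using hφ.square_integrable

lemma IsCuspidalL2.integrable_mul_conj_out (hφ : IsCuspidalL2 μ ω φ) (hψ : IsCuspidalL2 μ ω ψ) :
    Integrable (fun x : AutQuot F => φ x.out * conj (ψ x.out)) μ := by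
  refine (hφ.integrable_norm_sq_out.add hψ.integrable_norm_sq_out).mono'
    (hφ.measurable_mul_conj_out hψ).aestronglyMeasurable (.of_forall fun x => ?_)
  rw [norm_mul, RCLike.norm_conj, Pi.add_apply]
  nlinarith [sq_nonneg (‖φ x.out‖ - ‖ψ x.out‖), sq_nonneg ‖φ x.out‖, sq_nonneg ‖ψ x.out‖]

lemma IsCuspidalL2.ae_eq_zero (hφ : IsCuspidalL2 μ ω φ) (h : sqNorm μ φ = 0) :
    ∀ᵐ x : AutQuot F ∂μ, φ x.out = 0 := by
  have hm : Measurable fun x : AutQuot F => ‖φ x.out‖ₑ ^ 2 := by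
    simpa only [enorm_norm_sq] using hφ.measurable_norm_sq_out.enorm
  filter_upwards [(lintegral_eq_zero_iff hm).1 h] with x hx
  simpa using hx

/-- The inner product of `L²(GL₂(F) \ GL₂(𝔸_F), ω)`, linear in the first variable. -/
noncomputable def pairing (μ : Measure (AutQuot F)) (φ ψ : AdelicGL2 F → ℂ) : ℂ :=
  ∫ x : AutQuot F, φ x.out * conj (ψ x.out) ∂μ

lemma conj_pairing (φ ψ : AdelicGL2 F → ℂ) : conj (pairing μ φ ψ) = pairing μ ψ φ := by
  rw [pairing, ← integral_conj, pairing]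
  congr 1
  ext x
  simp [mul_comm]

lemma pairing_smul_left (c : ℂ) (φ ψ : AdelicGL2 F → ℂ) :
    pairing μ (c • φ) ψ = c * pairing μ φ ψ := by
  simp only [pairing, Pi.smul_apply, smul_eq_mul, mul_assoc, integral_const_mul]

lemma IsCuspidalL2.pairing_self_ne_zero (hφ : IsCuspidalL2 μ ω φ) (h : sqNorm μ φ ≠ 0) :
    pairing μ φ φ ≠ 0 := by
  have h1 : pairing μ φ φ = ((∫ x : AutQuot F, ‖φ x.out‖ ^ 2 ∂μ : ℝ) : ℂ) := by
    rw [pairing]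
    refine Eq.trans ?_ integral_ofReal
    congr 1
    ext x
    rw [Complex.mul_conj, Complex.normSq_eq_norm_sq]
    rfl
  rw [h1, Ne, Complex.ofReal_eq_zero,
    integral_eq_zero_iff_of_nonneg (fun x => by positivity) hφ.integrable_norm_sq_out]
  refine fun h0 => h ?_
  rw [sqNorm, lintegral_congr_ae (g := 0), Pi.zero_def, lintegral_zero]
  filter_upwards [h0] with x hx
  have : ‖φ x.out‖ ^ 2 = 0 := hx
  simpa using this

section ClosedInvariant

variable {V : Submodule ℂ (AdelicGL2 F → ℂ)}

lemma IsClosedInvariant.pairing_add_left (hV : IsClosedInvariant μ ω V) (hφ : φ ∈ V) (hφ' : φ' ∈ V)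
    (hψ : ψ ∈ V) : pairing μ (φ + φ') ψ = pairing μ φ ψ + pairing μ φ' ψ := by
  simp only [pairing, Pi.add_apply, add_mul]
  exact integral_add ((hV.isCuspidalL2 _ hφ).integrable_mul_conj_out (hV.isCuspidalL2 _ hψ))
    ((hV.isCuspidalL2 _ hφ').integrable_mul_conj_out (hV.isCuspidalL2 _ hψ))

lemma IsClosedInvariant.pairing_sum_left (hV : IsClosedInvariant μ ω V) {ι : Type*} (s : Finset ι)
    {f : ι → AdelicGL2 F → ℂ} (hf : ∀ i, f i ∈ V) (hψ : ψ ∈ V) :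
    pairing μ (∑ i ∈ s, f i) ψ = ∑ i ∈ s, pairing μ (f i) ψ := by
  simp only [pairing, Finset.sum_apply, Finset.sum_mul]
  exact integral_finsetSum s fun i _ =>
    (hV.isCuspidalL2 _ (hf i)).integrable_mul_conj_out (hV.isCuspidalL2 _ hψ)

/-- Sphericity and the Hecke eigenvalue equations hold only up to `sqNorm` zero; this is how they
enter the pairing. -/
lemma IsClosedInvariant.pairing_congr_left (hV : IsClosedInvariant μ ω V) (hφ : φ ∈ V)
    (hφ' : φ' ∈ V) (h : sqNorm μ (φ - φ') = 0) (ψ : AdelicGL2 F → ℂ) :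
    pairing μ φ ψ = pairing μ φ' ψ := by
  refine integral_congr_ae ?_
  filter_upwards [(hV.isCuspidalL2 _ (V.sub_mem hφ hφ')).ae_eq_zero h] with x hx
  rw [sub_eq_zero.1 hx]

lemma IsClosedInvariant.pairing_rightReg (hV : IsClosedInvariant μ ω V)
    (hμ : IsInvariantMeasure μ) (hφ : φ ∈ V) (hψ : ψ ∈ V) (g : AdelicGL2 F) :
    pairing μ (rightReg g φ) (rightReg g ψ) = pairing μ φ ψ := by
  have hφ' := hV.isCuspidalL2 _ hφ
  have hψ' := hV.isCuspidalL2 _ hψ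
  conv_rhs => rw [pairing, ← hμ.map_eq g, integral_map (measurable_rightTranslate g).aemeasurable
    (hφ'.measurable_mul_conj_out hψ').aestronglyMeasurable]
  refine integral_congr_ae (.of_forall fun x => ?_)
  exact ((hφ'.isLeftInvariant_mul_conj hψ').apply_out_rightTranslate g x).symm

lemma rightReg_mul (g h : AdelicGL2 F) (φ : AdelicGL2 F → ℂ) :
    rightReg (g * h) φ = rightReg g (rightReg h φ) := by
  ext x
  simp [rightReg, mul_assoc]

lemma IsClosedInvariant.pairing_rightReg_left (hV : IsClosedInvariant μ ω V)
    (hμ : IsInvariantMeasure μ) (hφ : φ ∈ V) (hψ : ψ ∈ V) (g : AdelicGL2 F) :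
    pairing μ (rightReg g φ) ψ = pairing μ φ (rightReg g⁻¹ ψ) := by
  rw [← hV.pairing_rightReg hμ hφ (hV.invariant g⁻¹ ψ hψ) g, ← rightReg_mul, mul_inv_cancel]
  congr 1
  ext x
  simp [rightReg]

end ClosedInvariant

/-! ### Spherical vectors -/

/-- The maximal compact subgroup `GL₂(𝒪_v)` inside `GL₂(𝔸_F)`. -/
noncomputable def integralAt (v : HeightOneSpectrum (𝓞 F)) : Subgroup (AdelicGL2 F) :=
  ((gl2At v).comp (Matrix.GeneralLinearGroup.map
    (algebraMap (v.adicCompletionIntegers F) (v.adicCompletion F)))).range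

variable {v : HeightOneSpectrum (𝓞 F)} {π : CuspRep μ}

lemma IsSpherical.pairing_integralAt (hφ : IsSpherical π v φ) {k : AdelicGL2 F}
    (hk : k ∈ integralAt v) (ψ : AdelicGL2 F → ℂ) :
    pairing μ (rightReg k φ) ψ = pairing μ φ ψ := by
  obtain ⟨k, rfl⟩ := hk
  exact π.isClosedInvariant.pairing_congr_left (π.isClosedInvariant.invariant _ _ hφ.mem) hφ.mem
    (hφ.fixed k) ψ

/-- Matrix coefficients of spherical vectors are bi-invariant under `GL₂(𝒪_v)`. -/
lemma IsSpherical.pairing_doubleCoset (hφ : IsSpherical π v φ) (hμ : IsInvariantMeasure μ)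
    {k k' : AdelicGL2 F} (hk : k ∈ integralAt v) (hk' : k' ∈ integralAt v) (g : AdelicGL2 F) :
    pairing μ (rightReg (k * g * k') φ) φ = pairing μ (rightReg g φ) φ := by
  have hV := π.isClosedInvariant
  have hm := hφ.mem
  -- `k` passes to the second slot as `k⁻¹`, where conjugate symmetry lets `φ` absorb it. Then `g`
  -- is moved across to expose `k'` and moved back.
  rw [mul_assoc, rightReg_mul, hV.pairing_rightReg_left hμ (hV.invariant _ _ hm) hm,
    ← conj_pairing, hφ.pairing_integralAt (inv_mem hk), conj_pairing, rightReg_mul,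
    hV.pairing_rightReg_left hμ (hV.invariant _ _ hm) hm, hφ.pairing_integralAt hk',
    hV.pairing_rightReg_left hμ hm hm]

/-! ### Matrix identities at `v`: the Hecke representatives as elements of `K diag(ϖ,1) K` -/

lemma gl2At_upperTri_scalar (v : HeightOneSpectrum (𝓞 F)) (a : (v.adicCompletion F)ˣ) :
    gl2At v (upperTri a a 0) = Matrix.GeneralLinearGroup.scalar (Fin 2) (ideleAt v a) := by
  ext i j
  change (1 + (matEmb (adeleAt v) (_ - 1) : Matrix (Fin 2) (Fin 2) (Adele F))) i j =
    Matrix.scalar (Fin 2) ((ideleAt v a : Idele F) : Adele F) i j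
  have h : ((ideleAt v a : Idele F) : Adele F) = 1 + adeleAt v (a - 1) := rfl
  rw [h, Matrix.add_apply]
  change _ + adeleAt v ((upperTri a a 0 - 1 : Matrix (Fin 2) (Fin 2) (v.adicCompletion F)) i j) = _
  fin_cases i <;> fin_cases j <;> simp [upperTri, Matrix.GeneralLinearGroup.mkOfDetNeZero]

lemma commute_scalar (z : Idele F) (g : AdelicGL2 F) :
    g * Matrix.GeneralLinearGroup.scalar (Fin 2) z =
      Matrix.GeneralLinearGroup.scalar (Fin 2) z * g := by
  apply Units.ext
  change (g : Matrix (Fin 2) (Fin 2) (Adele F)) * Matrix.scalar (Fin 2) (z : Adele F) =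
    Matrix.scalar (Fin 2) (z : Adele F) * g
  exact (Matrix.scalar_commute (z : Adele F) (fun r => mul_comm _ _) _).symm

lemma IsCuspidalL2.rightReg_scalar (hφ : IsCuspidalL2 μ ω φ) (z : Idele F) :
    rightReg (Matrix.GeneralLinearGroup.scalar (Fin 2) z) φ = ω.val z • φ := by
  ext g
  rw [rightReg, commute_scalar, hφ.central]
  rfl

lemma upperTri_one_mem_integralAt {b : v.adicCompletion F} (hb : b ∈ v.adicCompletionIntegers F) :
    gl2At v (upperTri 1 1 b) ∈ integralAt v := by
  refine ⟨Matrix.GeneralLinearGroup.upperRightHom ⟨b, hb⟩, ?_⟩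
  rw [MonoidHom.comp_apply]
  congr 1
  ext i j
  fin_cases i <;> fin_cases j <;> simp [upperTri, Matrix.GeneralLinearGroup.mkOfDetNeZero]

/-- The Weyl element of `GL₂`. -/
def weyl (R : Type*) [CommRing R] : Matrix.GeneralLinearGroup (Fin 2) R :=
  ⟨!![0, 1; 1, 0], !![0, 1; 1, 0], by simp [Matrix.one_fin_two], by simp [Matrix.one_fin_two]⟩

lemma weyl_mem_integralAt (v : HeightOneSpectrum (𝓞 F)) :
    gl2At v (weyl (v.adicCompletion F)) ∈ integralAt v := by
  refine ⟨weyl _, ?_⟩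
  rw [MonoidHom.comp_apply]
  congr 1
  ext i j
  fin_cases i <;> fin_cases j <;> simp [weyl]

lemma upperTri_eq_unipotent_mul (a : (v.adicCompletion F)ˣ) (b : v.adicCompletion F) :
    upperTri a 1 b = upperTri 1 1 b * upperTri a 1 0 := by
  ext i j
  fin_cases i <;> fin_cases j <;>
    simp [upperTri, Matrix.GeneralLinearGroup.mkOfDetNeZero, Matrix.mul_apply]

lemma upperTri_eq_weyl_mul (a : (v.adicCompletion F)ˣ) :
    upperTri 1 a 0 = weyl (v.adicCompletion F) * upperTri a 1 0 * weyl (v.adicCompletion F) := by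
  ext i j
  fin_cases i <;> fin_cases j <;>
    simp [upperTri, Matrix.GeneralLinearGroup.mkOfDetNeZero, Matrix.mul_apply, weyl]

/-- Modulo the centre, `diag(1,a)` inverts `diag(a,1)`; this is the source of the self-adjointness
up to `ω`. -/
lemma upperTri_mul_upperTri (a : (v.adicCompletion F)ˣ) :
    upperTri 1 a 0 * upperTri a 1 0 = upperTri (v := v) a a 0 := by
  ext i j
  fin_cases i <;> fin_cases j <;>
    simp [upperTri, Matrix.GeneralLinearGroup.mkOfDetNeZero, Matrix.mul_apply]

instance (v : HeightOneSpectrum (𝓞 F)) : Finite (𝓞 F ⧸ v.asIdeal) :=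
  Ideal.finiteQuotientOfFreeOfNeBot _ v.ne_bot

/-- Finiteness of the residue ring rules out the default value `0` of `∑ᶠ`. -/
lemma heckeT_eq_sum [Fintype (𝓞 F ⧸ v.asIdeal)] (ϖ : (v.adicCompletion F)ˣ)
    (φ : AdelicGL2 F → ℂ) :
    heckeT v ϖ φ = (∑ b : 𝓞 F ⧸ v.asIdeal,
      rightReg (gl2At v (upperTri ϖ 1 ((algebraMap (𝓞 F) F b.out : F) : v.adicCompletion F))) φ)
      + rightReg (gl2At v (upperTri 1 ϖ 0)) φ := by
  ext g
  rw [heckeT, finsum_eq_sum_of_fintype, Pi.add_apply, Finset.sum_apply]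
  rfl

lemma IsSpherical.heckeT_mem (hφ : IsSpherical π v φ) (ϖ : (v.adicCompletion F)ˣ) :
    heckeT v ϖ φ ∈ π.space := by
  have := Fintype.ofFinite (𝓞 F ⧸ v.asIdeal)
  rw [heckeT_eq_sum]
  exact add_mem (sum_mem fun b _ => π.isClosedInvariant.invariant _ _ hφ.mem)
    (π.isClosedInvariant.invariant _ _ hφ.mem)

/-- The matrix coefficient of a spherical vector at `diag(ϖ, 1)` differs from its conjugate by the
central character. -/
lemma IsSpherical.pairing_diag_eq (hφ : IsSpherical π v φ) (hμ : IsInvariantMeasure μ)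
    (ϖ : (v.adicCompletion F)ˣ) :
    pairing μ (rightReg (gl2At v (upperTri ϖ 1 0)) φ) φ =
      π.centralChar.val (ideleAt v ϖ) *
        conj (pairing μ (rightReg (gl2At v (upperTri ϖ 1 0)) φ) φ) := by
  have hV := π.isClosedInvariant
  have hW := weyl_mem_integralAt v
  have h1 : pairing μ (rightReg (gl2At v (upperTri 1 ϖ 0)) φ) φ =
      pairing μ (rightReg (gl2At v (upperTri ϖ 1 0)) φ) φ := by
    rw [upperTri_eq_weyl_mul, map_mul, map_mul, hφ.pairing_doubleCoset hμ hW hW]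
  -- Translating both slots by `diag(1,ϖ)` turns the first into `ω(ϖ) φ`.
  conv_lhs => rw [← hV.pairing_rightReg hμ (hV.invariant _ _ hφ.mem) hφ.mem (gl2At v (upperTri 1 ϖ 0)),
    ← rightReg_mul, ← map_mul, upperTri_mul_upperTri, gl2At_upperTri_scalar,
    (hV.isCuspidalL2 _ hφ.mem).rightReg_scalar, pairing_smul_left, ← conj_pairing, h1]

/-- The Hecke operator at `v` on spherical vectors: its adjoint is its product with the inverse of
the central character. -/
lemma IsSpherical.pairing_heckeT_eq (hφ : IsSpherical π v φ) (hμ : IsInvariantMeasure μ)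
    (ϖ : (v.adicCompletion F)ˣ) :
    pairing μ (heckeT v ϖ φ) φ =
      π.centralChar.val (ideleAt v ϖ) * conj (pairing μ (heckeT v ϖ φ) φ) := by
  have := Fintype.ofFinite (𝓞 F ⧸ v.asIdeal)
  have hV := π.isClosedInvariant
  have hW := weyl_mem_integralAt v
  have h1 : pairing μ (rightReg (gl2At v (upperTri 1 ϖ 0)) φ) φ =
      pairing μ (rightReg (gl2At v (upperTri ϖ 1 0)) φ) φ := by
    rw [upperTri_eq_weyl_mul, map_mul, map_mul, hφ.pairing_doubleCoset hμ hW hW]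
  have h2 (b : 𝓞 F) : pairing μ (rightReg
      (gl2At v (upperTri ϖ 1 ((algebraMap (𝓞 F) F b : F) : v.adicCompletion F))) φ) φ =
      pairing μ (rightReg (gl2At v (upperTri ϖ 1 0)) φ) φ := by
    rw [upperTri_eq_unipotent_mul, map_mul, ← mul_one (_ * _), hφ.pairing_doubleCoset hμ
      (upperTri_one_mem_integralAt (v.coe_algebraMap_mem (𝓞 F) F b)) (one_mem _)]
  rw [heckeT_eq_sum, hV.pairing_add_left (sum_mem fun b _ => hV.invariant _ _ hφ.mem)
    (hV.invariant _ _ hφ.mem) hφ.mem, hV.pairing_sum_left _ (fun b => hV.invariant _ _ hφ.mem)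
    hφ.mem, h1]
  simp only [h2, Finset.sum_const, nsmul_eq_mul, map_add, map_mul, map_natCast]
  -- All cosets contribute equally; their number is a common factor and its value plays no role.
  linear_combination ((Finset.univ : Finset (𝓞 F ⧸ v.asIdeal)).card + 1 : ℂ) *
    hφ.pairing_diag_eq hμ ϖ

lemma one_lt_resCard (v : HeightOneSpectrum (𝓞 F)) : 1 < resCard v :=
  NumberField.HeightOneSpectrum.one_lt_absNorm v

lemma CuspRep.IsSatakeParameters.isUnitaryPair {α : Fin 2 → ℂ} {ϖ : (v.adicCompletion F)ˣ}
    (hα : π.IsSatakeParameters v ϖ α) (hμ : IsInvariantMeasure μ) :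
    IsUnitaryPair α (π.centralChar.val (ideleAt v ϖ)) := by
  obtain ⟨φ, hφ, hT, hZ⟩ := hα
  have hV := π.isClosedInvariant
  have hne := (hV.isCuspidalL2 _ hφ.mem).pairing_self_ne_zero hφ.nonzero
  refine ⟨HeckeChar.val_mul_conj _ _, ?_, ?_⟩
  · have h := hV.pairing_congr_left (hV.invariant _ _ hφ.mem) (π.space.smul_mem _ hφ.mem) hZ φ
    rw [gl2At_upperTri_scalar, (hV.isCuspidalL2 _ hφ.mem).rightReg_scalar, pairing_smul_left,
      pairing_smul_left] at h
    exact (mul_right_cancel₀ hne h).symm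
  · have h := hV.pairing_congr_left (hφ.heckeT_mem ϖ) (π.space.smul_mem _ hφ.mem) hT φ
    have h' := hφ.pairing_heckeT_eq hμ ϖ
    rw [h, pairing_smul_left, map_mul, conj_pairing, map_mul, Complex.conj_ofReal] at h'
    have hq : (Real.sqrt (resCard v) : ℂ) ≠ 0 := by
      have := one_lt_resCard v
      exact_mod_cast (Real.sqrt_pos.2 (by positivity)).ne'
    -- `√q_v` and `⟨φ, φ⟩` are fixed by conjugation, so they cancel from both sides.
    refine mul_left_cancel₀ (mul_ne_zero hq hne) ?_
    linear_combination h'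

end AutRep

theorem lemma3p2 {F : Type*} [Field F] [NumberField F]
    (μ : MeasureTheory.Measure (AutRep.AutQuot F)) (hμ : AutRep.IsInvariantMeasure μ)
    (π π' : AutRep.CuspRep μ) (χ : AutRep.HeckeChar F)
    (hππ' : ¬ AutRep.TwistEquivalent π π')
    (v : IsDedekindDomain.HeightOneSpectrum (NumberField.RingOfIntegers F))
    (hπ : π.IsUnramifiedAt v) (hπ' : π'.IsUnramifiedAt v) (hχ : χ.IsUnramifiedAt v)
    (ϖ : (v.adicCompletion F)ˣ) (hϖ : AutRep.IsUnif ϖ)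
    (α α' : Fin 2 → ℂ)
    (hα : π.IsSatakeParameters v ϖ α) (hα' : π'.IsSatakeParameters v ϖ α')
    (D : List (ℕ × Multiset ℂ))
    (hD : D = AutRep.factorsD α α' (π.centralChar.val (AutRep.ideleAt v ϖ))
      (π'.centralChar.val (AutRep.ideleAt v ϖ)) (χ.val (AutRep.ideleAt v ϖ))) :
    (∃ σ₀ : ℝ, ∀ s : ℂ, σ₀ < s.re →
      HasSum (fun ℓ : ℕ => AutRep.coeffD D (ℓ + 1) * (Real.log (AutRep.resCard v) : ℂ) *
          (AutRep.resCard v : ℂ) ^ (-((ℓ + 1 : ℕ) : ℂ) * s))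
        (-(logDeriv (AutRep.eulerD (AutRep.resCard v) D) s))) ∧
    ∀ ℓ : ℕ, 1 ≤ ℓ → 0 ≤ (AutRep.coeffD D ℓ).re ∧ (AutRep.coeffD D ℓ).im = 0 := by
  refine ⟨AutRep.exists_hasSum_logDeriv_eulerD (AutRep.one_lt_resCard v) D, fun ℓ _ => ?_⟩
  rw [hD, AutRep.coeffD_factorsD (hα.isUnitaryPair hμ) (hα'.isUnitaryPair hμ)
    (χ.val_mul_conj _) ℓ]
  exact ⟨Complex.normSq_nonneg _, Complex.ofReal_im _⟩
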